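/- **Lemma 2.4.** Let $\mathcal H$ be a separable complex Hilbert space, let $H_0$ be a (possibly unbounded) self-adjoint operator in $\mathcal H$ with resolvent set $\rho(H_0)$, and let $V=V^*$ be a bounded operator on $\mathcal H$. Suppose that $V(H_0+z_0I)^{-1}$ is compact for some $z_0\in\mathbb C$ with $-z_0\in\rho(H_0)$. Assume in addition that $0\in\rho(H_0)\cup\sigma_d(H_0)$, where $\sigma_d(H_0)$ is the set of eigenvalues of $H_0$ of finite multiplicity that are isolated points of the spectrum of $H_0$, and that (i) $V_-=\tfrac12(|V|-V)$ has finite rank, where $|V|=(V^*V)^{1/2}$; (ii) $\ker V=\{0\}$. Then $V(H_0+zI)^{-1}$ is compact for all $z\in\mathbb C$ with $-z\in\rho(H_0)$, and the set $$\{t\in\mathbb C : 0 \text{ is an eigenvalue of } H_0+tV\}$$ (where $H_0+tV$ has domain $\operatorname{dom}(H_0)$) has no accumulation point in $\mathbb C$. -/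

import Mathlib

namespace LinearPMap

variable {H : Type*} [NormedAddCommGroup H] [NormedSpace ℂ H]

/-- `R` is the bounded resolvent `(T - z I)⁻¹`: an everywhere defined bounded operator which maps
`H` into `dom T` and is a two-sided inverse of `T - z I : dom T → H`. -/
def IsResolventAt (T : H →ₗ.[ℂ] H) (z : ℂ) (R : H →L[ℂ] H) : Prop :=
  (∀ y : H, ∃ h : R y ∈ T.domain, T ⟨R y, h⟩ - z • R y = y) ∧
    ∀ x : T.domain, R (T x - z • (x : H)) = x

/-- The resolvent set `ρ(T)` of an unbounded operator. -/
def resolventSet (T : H →ₗ.[ℂ] H) : Set ℂ :=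
  {z | ∃ R : H →L[ℂ] H, T.IsResolventAt z R}

/-- The spectrum `σ(T)`, the complement of the resolvent set. -/
def spectrum (T : H →ₗ.[ℂ] H) : Set ℂ :=
  T.resolventSetᶜ

/-- The eigenspace `ker (T - z I)`, as a subspace of `H`. -/
def eigenspace (T : H →ₗ.[ℂ] H) (z : ℂ) : Submodule ℂ H :=
  (LinearMap.ker (T.toFun - z • T.domain.subtype)).map T.domain.subtype

/-- The point spectrum `σ_p(T)`, the set of eigenvalues. -/
def pointSpectrum (T : H →ₗ.[ℂ] H) : Set ℂ :=
  {z | ∃ x : T.domain, (x : H) ≠ 0 ∧ T x = z • (x : H)}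

/-- The discrete spectrum `σ_d(T)` of a self-adjoint operator: the eigenvalues of finite
multiplicity that are isolated points of the spectrum (for a self-adjoint operator the algebraic
and geometric multiplicities agree). -/
def discreteSpectrum (T : H →ₗ.[ℂ] H) : Set ℂ :=
  {z | z ∈ T.pointSpectrum ∧ FiniteDimensional ℂ (T.eigenspace z) ∧
    ¬ AccPt z (Filter.principal T.spectrum)}

/-- The operator `T + t V` with domain `dom T`, for a bounded operator `V`. -/
def perturb (T : H →ₗ.[ℂ] H) (V : H →L[ℂ] H) (t : ℂ) : H →ₗ.[ℂ] H :=
  (t • (V : H →ₗ[ℂ] H)) +ᵥ T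

end LinearPMap

/-- The negative part `V₋ = (|V| - V) / 2` of a bounded self-adjoint operator, where
`|V| = (V* V)^(1/2)`. -/
noncomputable def ContinuousLinearMap.negativePart {H : Type*} [NormedAddCommGroup H]
    [InnerProductSpace ℂ H] [CompleteSpace H] (V : H →L[ℂ] H) : H →L[ℂ] H :=
  (2⁻¹ : ℂ) • (CFC.abs V - V)

/-- A set in a topological space that has no accumulation point in that space. -/
def HasNoAccPt {X : Type*} [TopologicalSpace X] (S : Set X) : Prop :=
  ∀ x : X, ¬ AccPt x (Filter.principal S)

/-! Writing x = R y with a resolvent R of H₀ at z turns (H₀ + tV)x = 0 into (A + tK)y = 0, where A =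
1 + zR and K = VR is compact. The assumption on 0 makes A invertible up to a compact operator.
Hence, if A + t₀K is injective for a single t₀, it has a bounded inverse, and the other bad t
correspond to nonzero eigenvalues of the compact operator (A + t₀K)⁻¹K, which can accumulate only at
0, that is, t only at infinity.

Such a t₀ exists on the positive imaginary axis. Otherwise infinitely many independent null vectors
there would span a space on which the form ⟨Vx, x⟩ vanishes. As V₋ has finite rank, it kills some
nonzero x in that space; then Vx = |V|x and ⟨|V|x, x⟩ = 0, so Vx = 0, against ker V = 0. -/

open Module End Filter Topology

/-! ### Riesz theory and the Fredholm alternative -/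

namespace IsCompactOperator

theorem finite_setOf_hasEigenvalue {X : Type*} [NormedAddCommGroup X] [NormedSpace ℂ X]
    {C : X →L[ℂ] X} (hC : IsCompactOperator C) {c : ℝ} (hc : 0 < c) :
    {μ : ℂ | HasEigenvalue (C : End ℂ X) μ ∧ c ≤ ‖μ‖}.Finite := by
  by_contra hinf
  let e := Set.Infinite.natEmbedding _ hinf
  let μ : ℕ → ℂ := fun n => (e n : ℂ)
  have hμinj : Function.Injective μ := Subtype.val_injective.comp e.injective
  have hμ : ∀ n, c ≤ ‖μ n‖ := fun n => (e n).2.2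
  have hv' : ∀ n, ∃ v, HasEigenvector (C : End ℂ X) (μ n) v :=
    fun n => (e n).2.1.exists_hasEigenvector
  choose v hv using hv'
  have hvC : ∀ n, C (v n) = μ n • v n := fun n => (hv n).apply_eq_smul
  have hli : LinearIndependent ℂ v := eigenvectors_linearIndependent' _ μ hμinj v hv
  let E : ℕ → Submodule ℂ X := fun n => Submodule.span ℂ (v '' Set.Iio n)
  have hEmono : Monotone E := fun m n h =>
    Submodule.span_mono (Set.image_mono (Set.Iio_subset_Iio h))
  have hEfin : ∀ n, FiniteDimensional ℂ (E n) := fun n =>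
    FiniteDimensional.span_of_finite ℂ ((Set.finite_Iio n).image v)
  have hvE : ∀ n, v n ∈ E (n + 1) := fun n =>
    Submodule.subset_span ⟨n, Nat.lt_succ_self n, rfl⟩
  have hvnE : ∀ n, v n ∉ E n := fun n => hli.notMem_span_image (by simp)
  have hEC : ∀ n, ∀ x ∈ E n, C x ∈ E n := by
    intro n x hx
    have : E n ≤ (E n).comap (C : X →ₗ[ℂ] X) := by
      refine Submodule.span_le.2 ?_
      rintro _ ⟨k, hk, rfl⟩
      change C (v k) ∈ E n
      rw [hvC]
      exact Submodule.smul_mem _ _ (Submodule.subset_span ⟨k, hk, rfl⟩)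
    exact this hx
  have hEC' : ∀ n, ∀ x ∈ E (n + 1), C x - μ n • x ∈ E n := by
    intro n x hx
    have : E (n + 1) ≤ (E n).comap ((C : X →ₗ[ℂ] X) - μ n • LinearMap.id) := by
      refine Submodule.span_le.2 ?_
      rintro _ ⟨k, hk, rfl⟩
      change C (v k) - μ n • v k ∈ E n
      rw [hvC, ← sub_smul]
      rcases (Nat.lt_succ_iff_lt_or_eq.1 hk) with h | h
      · exact Submodule.smul_mem _ _ (Submodule.subset_span ⟨k, h, rfl⟩)
      · simp [h]
    exact this hx
  -- Almost orthogonal vectors from Riesz's lemma: `C` will map this bounded sequence to a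
  -- `c`-separated one, contradicting compactness.
  have hy' : ∀ n, ∃ y ∈ E (n + 1), ‖y‖ ≤ 3 ∧ ∀ w ∈ E n, 1 ≤ ‖y - w‖ := by
    intro n
    have hcl : IsClosed (((E n).comap (E (n + 1)).subtype : Submodule ℂ (E (n + 1))) :
        Set (E (n + 1))) := Submodule.closed_of_finiteDimensional _
    obtain ⟨y, hy, hyw⟩ := riesz_lemma_of_norm_lt (c := (2 : ℂ)) (R := 3) (by norm_num)
      (by norm_num) hcl ⟨⟨v n, hvE n⟩, hvnE n⟩
    exact ⟨y, y.2, hy, fun w hw => hyw ⟨w, hEmono n.le_succ hw⟩ hw⟩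
  choose y hyE hy3 hyw using hy'
  have key : ∀ m n, m < n → c ≤ ‖C (y n) - C (y m)‖ := by
    intro m n hmn
    have hμ0 : μ n ≠ 0 := norm_pos_iff.1 (hc.trans_le (hμ n))
    let u : X := (μ n)⁻¹ • (C (y m) - (C (y n) - μ n • y n))
    have hu : u ∈ E n := Submodule.smul_mem _ _ (Submodule.sub_mem _
      (hEC _ _ (hEmono hmn (hyE m))) (hEC' _ _ (hyE n)))
    have : C (y n) - C (y m) = μ n • (y n - u) := by
      rw [smul_sub, smul_inv_smul₀ hμ0]; abel
    rw [this, norm_smul]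
    nlinarith [hyw n u hu, hμ n, norm_nonneg (μ n)]
  obtain ⟨K, hK, hK'⟩ := hC.image_closedBall_subset_compact 3
  obtain ⟨z, -, ψ, hψ, hψz⟩ := hK.tendsto_subseq
    (fun n => hK' ⟨y n, by simpa using hy3 n, rfl⟩)
  obtain ⟨N, hN⟩ := Metric.cauchySeq_iff'.1 hψz.cauchySeq c hc
  have h1 := hN (N + 1) (by lia)
  rw [dist_eq_norm] at h1
  exact absurd (key _ _ (hψ (Nat.lt_succ_self N))) (not_le.2 h1)

variable {X : Type*} [NormedAddCommGroup X] [NormedSpace ℂ X] [CompleteSpace X]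

/-- With U = B + Q, U⁻¹B = 1 - U⁻¹Q, and injectivity of B excludes the eigenvalue 1 of the compact
U⁻¹Q. -/
theorem isUnit_of_add_isUnit {B Q : X →L[ℂ] X} (hQ : IsCompactOperator Q)
    (hU : IsUnit (B + Q)) (hB : ∀ x, B x = 0 → x = 0) : IsUnit B := by
  obtain ⟨U, hU⟩ := hU
  have hC : IsCompactOperator ((↑U⁻¹ : X →L[ℂ] X) * Q) := hQ.clm_comp _
  have hBU : (↑U⁻¹ : X →L[ℂ] X) * B = 1 - (↑U⁻¹ : X →L[ℂ] X) * Q := by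
    rw [eq_sub_iff_add_eq, ← mul_add, ← hU, Units.inv_mul]
  have hne : ¬ HasEigenvalue (((↑U⁻¹ : X →L[ℂ] X) * Q : X →L[ℂ] X) : End ℂ X) 1 := by
    intro h
    obtain ⟨x, hx⟩ := h.exists_hasEigenvector
    have h1 : ((↑U⁻¹ : X →L[ℂ] X) * Q) x = x := by simpa using hx.apply_eq_smul
    have h2 : ((↑U⁻¹ : X →L[ℂ] X) * B) x = 0 := by
      rw [hBU, sub_apply, h1]; simp
    have h3 : B x = 0 := by
      have := congrArg (U : X →L[ℂ] X) h2
      rwa [← mul_apply_eq_comp, ← mul_assoc, Units.mul_inv, one_mul, map_zero] at this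
    exact hx.2 (hB x h3)
  have hr := (hasEigenvalue_or_mem_resolventSet hC one_ne_zero).resolve_left hne
  rw [spectrum.mem_resolventSet_iff, map_one, ← hBU] at hr
  simpa using hr

end IsCompactOperator

theorem hasNoAccPt_of_finite_inter_ball {X : Type*} [MetricSpace X] {S : Set X}
    (h : ∀ x, (S ∩ Metric.ball x 1).Finite) : HasNoAccPt S := by
  intro x hx
  rw [accPt_iff_nhds] at hx
  have hcl : IsClosed ((S ∩ Metric.ball x 1) \ {x}) := ((h x).subset Set.sdiff_subset).isClosed
  obtain ⟨y, ⟨⟨hy1, hy2⟩, hyS⟩, hyx⟩ := hx (Metric.ball x 1 ∩ ((S ∩ Metric.ball x 1) \ {x})ᶜ)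
    (inter_mem (Metric.ball_mem_nhds x one_pos) (hcl.isOpen_compl.mem_nhds (by simp)))
  exact hy2 ⟨⟨hyS, hy1⟩, hyx⟩

theorem hasNoAccPt_setOf_not_injective_add_smul {X : Type*} [NormedAddCommGroup X]
    [NormedSpace ℂ X] [CompleteSpace X] {A K Q : X →L[ℂ] X} (hK : IsCompactOperator K)
    (hQ : IsCompactOperator Q) (hU : IsUnit (A + Q)) {t₀ : ℂ}
    (ht₀ : ∀ x, (A + t₀ • K) x = 0 → x = 0) :
    HasNoAccPt {t : ℂ | ∃ x, x ≠ 0 ∧ (A + t • K) x = 0} := by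
  have hG : IsUnit (A + t₀ • K) := by
    refine IsCompactOperator.isUnit_of_add_isUnit (Q := Q - t₀ • K) (hQ.sub (hK.smul t₀)) ?_ ht₀
    convert hU using 1
    abel
  obtain ⟨G, hG⟩ := hG
  have hC : IsCompactOperator ((↑G⁻¹ : X →L[ℂ] X) * K) := hK.clm_comp _
  refine hasNoAccPt_of_finite_inter_ball fun s => ?_
  have hpos : 0 < ‖s‖ + 1 + ‖t₀‖ := by positivity
  -- A null vector at t is an eigenvector of G⁻¹K for μ = -(t - t₀)⁻¹, and |t - t₀| ≤ ‖s‖ + 1 + ‖t₀‖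
  -- on the ball.
  refine ((hC.finite_setOf_hasEigenvalue (inv_pos.2 hpos)).image (fun μ => t₀ - μ⁻¹)).subset ?_
  rintro t ⟨⟨x, hx0, hx⟩, hts⟩
  have hxG : x + (t - t₀) • ((↑G⁻¹ : X →L[ℂ] X) * K) x = 0 := by
    have h1 : (A + t • K) = (G : X →L[ℂ] X) + (t - t₀) • K := by
      rw [hG, sub_smul]; abel
    rw [h1] at hx
    have h2 := congrArg (↑G⁻¹ : X →L[ℂ] X) hx
    rw [map_zero, add_apply, map_add, ← mul_apply_eq_comp,
      Units.inv_mul, smul_apply, map_smul] at h2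
    exact h2
  have ht : t - t₀ ≠ 0 := by
    intro h
    rw [h, zero_smul, add_zero] at hxG
    exact hx0 hxG
  refine ⟨-(t - t₀)⁻¹, ⟨?_, ?_⟩, by simp [inv_neg]⟩
  · refine hasEigenvalue_of_hasEigenvector (x := x) ⟨mem_eigenspace_iff.2 ?_, hx0⟩
    change ((↑G⁻¹ : X →L[ℂ] X) * K) x = _
    rw [← inv_smul_smul₀ ht (((↑G⁻¹ : X →L[ℂ] X) * K) x), eq_neg_of_add_eq_zero_right hxG,
      smul_neg, neg_smul]
  · rw [norm_neg, norm_inv]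
    refine inv_anti₀ (norm_pos_iff.2 ht) ?_
    rw [Metric.mem_ball, dist_eq_norm] at hts
    have h1 := norm_sub_le t t₀
    have h2 := norm_sub_norm_le t s
    linarith

/-! ### Resolvents and reduction to bounded operators -/

namespace LinearPMap

section Resolvent

variable {H : Type*} [NormedAddCommGroup H] [NormedSpace ℂ H] {T : H →ₗ.[ℂ] H} {z w : ℂ}
  {R R' : H →L[ℂ] H}

theorem IsResolventAt.mem_domain (h : T.IsResolventAt z R) (y : H) : R y ∈ T.domain := (h.1 y).1

theorem IsResolventAt.apply_mk (h : T.IsResolventAt z R) (y : H) :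
    T ⟨R y, h.mem_domain y⟩ = y + z • R y := sub_eq_iff_eq_add.1 (h.1 y).2

theorem IsResolventAt.injective (h : T.IsResolventAt z R) {y : H} (hy : R y = 0) : y = 0 := by
  have h1 := h.apply_mk y
  have h2 : (⟨R y, h.mem_domain y⟩ : T.domain) = 0 := Subtype.ext hy
  rw [h2, hy, smul_zero, add_zero, LinearPMap.map_zero] at h1
  exact h1.symm

theorem IsResolventAt.resolvent_identity (h : T.IsResolventAt z R) (h' : T.IsResolventAt w R')
    (y : H) : R' y = R y + (w - z) • R (R' y) := by
  have h1 : R (T ⟨R' y, h'.mem_domain y⟩ - z • R' y) = R' y := h.2 ⟨R' y, h'.mem_domain y⟩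
  rw [h'.apply_mk] at h1
  rw [← _root_.map_smul, ← _root_.map_add]
  refine h1.symm.trans (congrArg R ?_)
  module

theorem IsResolventAt.isCompactOperator_comp (h : T.IsResolventAt z R)
    (h' : T.IsResolventAt w R') {V : H →L[ℂ] H} (hV : IsCompactOperator (V ∘L R)) :
    IsCompactOperator (V ∘L R') := by
  have h1 : V ∘L R' = (V ∘L R) ∘L (1 + (w - z) • R') := by
    ext y
    change V (R' y) = V (R (y + (w - z) • R' y))
    rw [_root_.map_add, _root_.map_smul, ← h.resolvent_identity h' y]
  rw [h1]
  exact hV.comp_clm _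

theorem zero_mem_pointSpectrum_perturb_iff (V : H →L[ℂ] H) (t : ℂ) :
    (0 : ℂ) ∈ (T.perturb V t).pointSpectrum ↔
      ∃ x : T.domain, (x : H) ≠ 0 ∧ T x = -(t • V x) := by
  refine exists_congr fun (x : T.domain) => and_congr_right fun _ => ?_
  have : (T.perturb V t) x = t • V x + T x := rfl
  rw [this, zero_smul, add_eq_zero_iff_neg_eq, eq_comm]

theorem IsResolventAt.zero_mem_pointSpectrum_perturb_iff (h : T.IsResolventAt z R)
    (V : H →L[ℂ] H) (t : ℂ) :
    (0 : ℂ) ∈ (T.perturb V t).pointSpectrum ↔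
      ∃ y, y ≠ 0 ∧ ((1 + z • R) + t • (V ∘L R)) y = 0 := by
  rw [LinearPMap.zero_mem_pointSpectrum_perturb_iff]
  constructor
  · rintro ⟨x, hx0, hx⟩
    have h1 := h.2 x
    refine ⟨T x - z • (x : H), fun h0 => hx0 ?_, ?_⟩
    · rw [← h1, h0, _root_.map_zero]
    · change (T x - z • (x : H)) + z • R (T x - z • (x : H)) + t • V (R (T x - z • (x : H))) = 0
      rw [h1, hx]
      abel
  · rintro ⟨y, hy0, hy⟩
    refine ⟨⟨R y, h.mem_domain y⟩, fun h0 => hy0 (h.injective h0), ?_⟩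
    rw [h.apply_mk]
    exact eq_neg_of_add_eq_zero_left (by simpa using hy)

theorem IsResolventAt.notMem_spectrum (h : T.IsResolventAt z R) {μ : ℂ} (hμ : μ ≠ 0)
    (h' : z + μ⁻¹ ∈ T.resolventSet) : μ ∉ _root_.spectrum ℂ R := by
  obtain ⟨R', hR'⟩ := h'
  have e1 := h.resolvent_identity hR'
  have e2 := hR'.resolvent_identity h
  rw [spectrum.notMem_iff]
  refine ⟨⟨algebraMap ℂ _ μ - R, μ⁻¹ • (1 + μ⁻¹ • R'), ?_, ?_⟩, rfl⟩
  · ext y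
    have h1 : R (R' y) = μ • (R' y - R y) := by
      have := e1 y
      rw [add_sub_cancel_left] at this
      rw [this, add_sub_cancel_left, smul_inv_smul₀ hμ, ← this]
    change μ • (μ⁻¹ • (y + μ⁻¹ • R' y)) - R (μ⁻¹ • (y + μ⁻¹ • R' y)) = y
    rw [_root_.map_smul, _root_.map_add, _root_.map_smul, h1, smul_inv_smul₀ hμ,
      inv_smul_smul₀ hμ, add_sub_cancel]
    abel
  · ext y
    have h1 : R' (R y) = μ • (R' y - R y) := by
      have := e2 y
      rw [sub_add_cancel_left] at this
      rw [eq_sub_of_add_eq this.symm, neg_smul, sub_neg_eq_add, add_sub_cancel_left,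
        smul_inv_smul₀ hμ]
    change μ⁻¹ • ((μ • y - R y) + μ⁻¹ • R' (μ • y - R y)) = y
    rw [_root_.map_sub, _root_.map_smul, h1, ← smul_sub, inv_smul_smul₀ hμ, sub_sub_cancel,
      sub_add_cancel, inv_smul_smul₀ hμ]

theorem mem_eigenspace_zero_of_apply_eq (h : T.IsResolventAt z R) (hz : z ≠ 0) {u : H}
    (hu : R u = -z⁻¹ • u) : u ∈ T.eigenspace 0 := by
  have h1 : R (-z • u) = u := by rw [_root_.map_smul, hu, smul_smul]; simp [hz]
  have h2 := h.apply_mk (-z • u)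
  refine ⟨⟨R (-z • u), h.mem_domain _⟩, ?_, h1⟩
  simp only [SetLike.mem_coe, LinearMap.mem_ker, zero_smul, sub_zero]
  change T _ = 0
  rw [h2, h1]
  simp

end Resolvent

variable {H : Type*} [NormedAddCommGroup H] [InnerProductSpace ℂ H] [CompleteSpace H]
  {T : H →ₗ.[ℂ] H}

theorem inner_apply_eq_of_isSelfAdjoint (hT : IsSelfAdjoint T) (x y : T.domain) :
    inner ℂ (T x) (y : H) = inner ℂ (x : H) (T y) := by
  have h := adjoint_isFormalAdjoint hT.dense_domain
  rw [isSelfAdjoint_def.1 hT] at h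
  exact h x y

theorem IsResolventAt.isSelfAdjoint (hT : IsSelfAdjoint T) {r : ℝ} {R : H →L[ℂ] H}
    (h : T.IsResolventAt r R) : IsSelfAdjoint R := by
  rw [ContinuousLinearMap.isSelfAdjoint_iff_isSymmetric]
  intro x y
  have h1 := inner_apply_eq_of_isSelfAdjoint hT ⟨R x, h.mem_domain x⟩ ⟨R y, h.mem_domain y⟩
  rw [h.apply_mk, h.apply_mk] at h1
  simp only [inner_add_left, inner_add_right, inner_smul_left, inner_smul_right,
    Complex.conj_ofReal, add_left_inj] at h1
  exact h1.symm

/-- If 0 is in the discrete spectrum, take a small real r in the resolvent set: R is then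
self-adjoint, and its spectral projection P at a = -1/r maps into ker H₀, so it has finite rank.
Adding it repairs 1 + rR = r(R - a). -/
theorem exists_isCompactOperator_isUnit (hT : IsSelfAdjoint T)
    (h0 : (0 : ℂ) ∈ T.resolventSet ∪ T.discreteSpectrum) :
    ∃ (z : ℂ) (R Q : H →L[ℂ] H), T.IsResolventAt z R ∧ IsCompactOperator Q ∧
      IsUnit (1 + z • R + Q) := by
  rcases h0 with ⟨R, hR⟩ | ⟨-, hfin, hacc⟩
  · exact ⟨0, R, 0, hR, isCompactOperator_zero, by simp⟩
  have hev : ∀ᶠ w in 𝓝 (0 : ℂ), w ≠ 0 → w ∈ T.resolventSet := by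
    rw [accPt_iff_frequently, not_frequently] at hacc
    filter_upwards [hacc] with w hw hw0
    by_contra hw1
    exact hw ⟨hw0, hw1⟩
  obtain ⟨δ, hδ, hball⟩ := Metric.eventually_nhds_iff.1 hev
  obtain ⟨r, hr0, hrδ⟩ := exists_between hδ
  have hrC : (r : ℂ) ≠ 0 := by exact_mod_cast hr0.ne'
  obtain ⟨R, hR⟩ := hball (y := (r : ℂ)) (by simpa [abs_of_pos hr0] using hrδ) hrC
  have hRsa := hR.isSelfAdjoint hT
  have hRn : IsStarNormal R := hRsa.isStarNormal
  set a : ℂ := -(r : ℂ)⁻¹ with ha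
  have ha0 : a ≠ 0 := neg_ne_zero.2 (inv_ne_zero hrC)
  have hiso : ∀ᶠ μ in 𝓝 a, μ ≠ a → μ ∉ _root_.spectrum ℂ R := by
    have hc : Tendsto (fun μ : ℂ => (r : ℂ) + μ⁻¹) (𝓝 a) (𝓝 0) := by
      have := (tendsto_inv₀ ha0).const_add (r : ℂ)
      simpa [ha, inv_neg] using this
    filter_upwards [hc.eventually hev, eventually_ne_nhds ha0] with μ h1 h2 h3
    refine hR.notMem_spectrum h2 (h1 fun h4 => h3 ?_)
    rw [ha, eq_neg_of_add_eq_zero_left h4, inv_neg, inv_inv, neg_neg]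
  classical
  let f : ℂ → ℂ := fun μ => if μ = a then 1 else 0
  -- The indicator of a is continuous on the spectrum because no other spectral point lies near a.
  have hf : ContinuousOn f (_root_.spectrum ℂ R) := by
    intro x hx
    by_cases hxa : x = a
    · subst hxa
      refine (continuousWithinAt_const (b := (1 : ℂ))).congr_of_eventuallyEq ?_ (by simp [f])
      filter_upwards [nhdsWithin_le_nhds hiso, self_mem_nhdsWithin] with μ h1 h2
      have : μ = a := by_contra fun h => h1 h h2
      simp [f, this]
    · refine (continuousWithinAt_const (b := (0 : ℂ))).congr_of_eventuallyEq ?_ (by simp [f, hxa])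
      filter_upwards [nhdsWithin_le_nhds (eventually_ne_nhds hxa)] with μ h1
      simp [f, h1]
  let P : H →L[ℂ] H := cfc f R
  have hRa : cfc (fun x : ℂ => x - a) R = R - algebraMap ℂ _ a := by
    rw [cfc_sub (fun x : ℂ => x) (fun _ => a) R, cfc_id' ℂ R, cfc_const a R]
  have hunit : IsUnit (R - algebraMap ℂ _ a + P) := by
    rw [← hRa, ← cfc_add R _ f, isUnit_cfc_iff _ R]
    intro x _
    by_cases hx : x = a
    · simp [f, hx]
    · simpa [f, hx] using sub_ne_zero.2 hx
  have hP : (R - algebraMap ℂ _ a) * P = 0 := by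
    rw [← hRa, ← cfc_mul _ _ R]
    have : (fun x : ℂ => (x - a) * f x) = fun _ => 0 := by
      ext x
      by_cases hx : x = a <;> simp [f, hx]
    rw [this]
    exact cfc_const_zero ℂ R
  have hPmem : ∀ x, P x ∈ T.eigenspace 0 := by
    intro x
    refine mem_eigenspace_zero_of_apply_eq hR hrC ?_
    have h1 := congrArg (fun B : H →L[ℂ] H => B x) hP
    rw [← ha]
    exact sub_eq_zero.1 h1
  have hPc : IsCompactOperator P := by
    have h1 : IsCompactOperator (P.codRestrict (T.eigenspace 0) hPmem) :=
      have : ProperSpace (T.eigenspace 0) := FiniteDimensional.proper ℂ _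
      isCompactOperator_of_locallyCompactSpace_dom (P.codRestrict (T.eigenspace 0) hPmem)
    exact h1.clm_comp (T.eigenspace 0).subtypeL
  refine ⟨r, R, (r : ℂ) • P, hR, hPc.smul (r : ℂ), ?_⟩
  have h1 : 1 + (r : ℂ) • R + (r : ℂ) • P = (r : ℂ) • (R - algebraMap ℂ _ a + P) := by
    rw [smul_add, smul_sub, Algebra.algebraMap_eq_smul_one, smul_smul, ha]
    simp [hrC]
    abel
  rw [h1]
  exact hunit.smul (Units.mk0 (r : ℂ) hrC)

-- Applying T to a relation ∑ cᵢxᵢ = 0 and cancelling the injective V gives ∑ cᵢμᵢxᵢ = 0;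
-- subtracting μₐ times the first relation removes the term a.
omit [CompleteSpace H] in
theorem linearIndependent_of_apply_eq_smul {ι : Type*} {T : H →ₗ.[ℂ] H} {V : H →L[ℂ] H}
    (hV : ∀ x, V x = 0 → x = 0) {μ : ι → ℂ} (hμ : Function.Injective μ) {x : ι → T.domain}
    (hx0 : ∀ i, (x i : H) ≠ 0) (hx : ∀ i, T (x i) = μ i • V (x i)) :
    LinearIndependent ℂ fun i => (x i : H) := by
  classical
  rw [linearIndependent_iff']
  intro s
  induction s using Finset.induction_on with
  | empty => simp
  | insert a s ha ih =>
    intro c hc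
    have h1 : ∑ i ∈ insert a s, (c i * μ i) • (x i : H) = 0 := by
      apply hV
      have h2 : (∑ i ∈ insert a s, c i • x i : T.domain) = 0 := by
        ext; simpa using hc
      have h3 : T.toFun (∑ i ∈ insert a s, c i • x i) = 0 := by rw [h2, _root_.map_zero]
      rw [map_sum] at h3
      rw [map_sum, ← h3]
      refine Finset.sum_congr rfl fun i _ => ?_
      rw [_root_.map_smul, _root_.map_smul, mul_smul, ← hx i]
      rfl
    have h4 : ∑ i ∈ insert a s, (c i * (μ i - μ a)) • (x i : H) = 0 := by
      have : ∀ i, (c i * (μ i - μ a)) • (x i : H) =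
          (c i * μ i) • (x i : H) - μ a • c i • (x i : H) := fun i => by module
      rw [Finset.sum_congr rfl fun i _ => this i, Finset.sum_sub_distrib, ← Finset.smul_sum, hc,
        h1]
      simp
    rw [Finset.sum_insert ha] at h4
    have h5 : ∀ i ∈ s, c i = 0 := by
      intro i hi
      have := ih (fun i => c i * (μ i - μ a)) (by simpa using h4) i hi
      refine (mul_eq_zero.1 this).resolve_right (sub_ne_zero.2 fun h => ?_)
      exact ha (hμ h ▸ hi)
    intro i hi
    rcases Finset.mem_insert.1 hi with rfl | hi
    · rw [Finset.sum_insert ha, Finset.sum_eq_zero fun j hj => by rw [h5 j hj, zero_smul],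
        add_zero] at hc
      exact (smul_eq_zero.1 hc).resolve_right (hx0 i)
    · exact h5 i hi

end LinearPMap

/-! ### Neutral vectors and a good parameter t₀ -/

namespace ContinuousLinearMap

variable {H : Type*} [NormedAddCommGroup H] [InnerProductSpace ℂ H] [CompleteSpace H]

theorem apply_eq_zero_of_negativePart_apply_eq_zero {V : H →L[ℂ] H} {x : H}
    (hx : V.negativePart x = 0) (hVx : inner ℂ (V x) x = 0) : V x = 0 := by
  have h1 : CFC.abs V x = V x := by
    have : (2⁻¹ : ℂ) • (CFC.abs V x - V x) = 0 := hx
    exact sub_eq_zero.1 ((smul_eq_zero.1 this).resolve_left (by norm_num))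
  obtain ⟨B, hB⟩ := CStarAlgebra.nonneg_iff_eq_star_mul_self.1 (CFC.abs_nonneg V)
  rw [← h1, hB] at hVx
  have h2 : B x = 0 := by
    rw [_root_.mul_apply_eq_comp, star_eq_adjoint, adjoint_inner_left] at hVx
    exact inner_self_eq_zero.1 hVx
  rw [← h1, hB, _root_.mul_apply_eq_comp, h2, _root_.map_zero]

end ContinuousLinearMap

namespace LinearPMap

variable {H : Type*} [NormedAddCommGroup H] [InnerProductSpace ℂ H] [CompleteSpace H]
  {T : H →ₗ.[ℂ] H}

theorem exists_zero_notMem_pointSpectrum_perturb (hT : IsSelfAdjoint T) {V : H →L[ℂ] H}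
    (hVsa : IsSelfAdjoint V) (hV : ∀ x, V x = 0 → x = 0)
    (hrank : FiniteDimensional ℂ (LinearMap.range (V.negativePart : H →ₗ[ℂ] H))) :
    ∃ t : ℂ, (0 : ℂ) ∉ (T.perturb V t).pointSpectrum := by
  by_contra! hall
  have hex : ∀ n : ℕ, ∃ x : T.domain, (x : H) ≠ 0 ∧
      T x = -((((n : ℂ) + 1) * Complex.I) • V x) := fun n =>
    (zero_mem_pointSpectrum_perturb_iff V _).1 (hall _)
  choose x hx0 hx using hex
  -- The shift by 1 keeps conj μₘ - μₙ = (m + n + 2)i nonzero even for m = n, so symmetry of T and V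
  -- forces ⟨Vxₘ, xₙ⟩ = 0 for all m, n.
  let μ : ℕ → ℂ := fun n => -(((n : ℂ) + 1) * Complex.I)
  have hxμ : ∀ n, T (x n) = μ n • V (x n) := fun n => by rw [hx, neg_smul]
  have hμinj : Function.Injective μ := fun m n h => by simpa [μ] using h
  have hli := linearIndependent_of_apply_eq_smul hV hμinj hx0 hxμ
  have horth : ∀ m n, inner ℂ (V (x m)) (x n : H) = 0 := by
    intro m n
    have h1 := inner_apply_eq_of_isSelfAdjoint hT (x m) (x n)
    have h2 : inner ℂ (V (x m)) (x n : H) = inner ℂ (x m : H) (V (x n)) :=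
      (ContinuousLinearMap.isSelfAdjoint_iff_isSymmetric.1 hVsa) (x m) (x n)
    rw [hxμ, hxμ, inner_smul_left, inner_smul_right, ← h2, ← sub_eq_zero, ← sub_mul] at h1
    refine (mul_eq_zero.1 h1).resolve_left fun h => ?_
    have h3 := congrArg Complex.im h
    simp [μ] at h3
    have : (0 : ℝ) < m + 1 + (n + 1) := by positivity
    linarith
  let Φ : (ℕ →₀ ℂ) →ₗ[ℂ] H := Finsupp.linearCombination ℂ fun n => (x n : H)
  have hneutral : ∀ c, inner ℂ (V (Φ c)) (Φ c) = 0 := by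
    intro c
    simp only [Φ, Finsupp.linearCombination_apply, Finsupp.sum, map_sum, sum_inner, inner_sum,
      _root_.map_smul, inner_smul_left, inner_smul_right, horth, mul_zero, Finset.sum_const_zero]
  let Ψ : (ℕ →₀ ℂ) →ₗ[ℂ] LinearMap.range (V.negativePart : H →ₗ[ℂ] H) :=
    (V.negativePart : H →ₗ[ℂ] H).rangeRestrict ∘ₗ Φ
  have hΨ : Function.Injective Ψ := by
    rw [← LinearMap.ker_eq_bot, LinearMap.ker_eq_bot']
    intro c hc
    have h1 : V.negativePart (Φ c) = 0 := congrArg Subtype.val hc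
    have h2 := hV _ (ContinuousLinearMap.apply_eq_zero_of_negativePart_apply_eq_zero h1
      (hneutral c))
    exact linearIndependent_iff.1 hli c h2
  have := Module.Finite.of_injective Ψ hΨ
  have h2 : Finite ℕ := (Finsupp.basisSingleOne (R := ℂ) (ι := ℕ)).linearIndependent.finite
  exact not_finite ℕ

end LinearPMap

theorem lemma2p4 {H : Type*} [NormedAddCommGroup H] [InnerProductSpace ℂ H] [CompleteSpace H]
    [TopologicalSpace.SeparableSpace H]
    (H₀ : H →ₗ.[ℂ] H) (hH₀ : IsSelfAdjoint H₀)
    (V : H →L[ℂ] H) (hV : IsSelfAdjoint V)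
    (hcompact : ∃ (z₀ : ℂ) (R : H →L[ℂ] H),
      H₀.IsResolventAt (-z₀) R ∧ IsCompactOperator (V ∘L R))
    (h0 : (0 : ℂ) ∈ H₀.resolventSet ∪ H₀.discreteSpectrum)
    (hrank : FiniteDimensional ℂ (LinearMap.range (V.negativePart : H →ₗ[ℂ] H)))
    (hker : LinearMap.ker (V : H →ₗ[ℂ] H) = ⊥) :
    (∀ (z : ℂ) (R : H →L[ℂ] H), H₀.IsResolventAt (-z) R → IsCompactOperator (V ∘L R)) ∧
      HasNoAccPt {t : ℂ | (0 : ℂ) ∈ (H₀.perturb V t).pointSpectrum} := by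
  obtain ⟨z₀, R₀, hR₀, hVR₀⟩ := hcompact
  refine ⟨fun z R hR => hR₀.isCompactOperator_comp hR hVR₀, ?_⟩
  obtain ⟨z, R, Q, hR, hQ, hU⟩ := LinearPMap.exists_isCompactOperator_isUnit hH₀ h0
  obtain ⟨t₀, ht₀⟩ := LinearPMap.exists_zero_notMem_pointSpectrum_perturb hH₀ hV
    (LinearMap.ker_eq_bot'.1 hker) hrank
  simp only [hR.zero_mem_pointSpectrum_perturb_iff] at ht₀ ⊢
  push Not at ht₀
  exact hasNoAccPt_setOf_not_injective_add_smul (hR₀.isCompactOperator_comp hR hVR₀) hQ hU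
    fun x hx => by_contra fun h => ht₀ x h hx
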